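/- **Chain Rule.** Let $M$ be a compact connected smooth $d$-dimensional Riemannian manifold without boundary, and let $\mathcal P_2(M)$ be the set of Borel probability measures on $M$ with the $2$-Wasserstein distance $\gamma_2$. A functional $F:\mathcal P_2(M)\to\mathbb R$ is *intrinsically differentiable* if for every $\mu$ and every smooth vector field $V$ with flow $\Phi^V$ the derivative $D_I^VF(\mu)=\frac{d}{d\varepsilon}\big|_{\varepsilon=0}F(\mu\circ(\Phi^V_\varepsilon)^{-1})$ exists, is linear in $V$, and is continuous in $V$ for the $L^2(\mu;TM)$-norm; its intrinsic derivative $D_IF(\mu)$ is the ($\mu$-a.e. unique) vector field in $L^2(\mu;TM)$ with $D_I^VF(\mu)=\int_M\langle D_IF(\mu)(u),V(u)\rangle_{T_uM}\,\mu(du)$ for all smooth $V$. We write $F\in C^{1,1}(\mathcal P_2(M))$ if $F$ is Lipschitz for $\gamma_2$ and intrinsically differentiable, and $D_IF$ has a version for which $D_IF(\mu)(\cdot)$ is a continuous vector field for every $\mu$ and $\|D_IF(\mu)(u)-D_IF(\nu)(u)\|_{T_uM}\le C\,\gamma_2(\mu,\nu)$ for all $\mu,\nu,u$, with a constant $C$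 independent of $u$. Let $F\in C^{1,1}(\mathcal P_2(M))$, let $J\subseteq\mathbb R$ be an interval, and let $x:J\times M\to M$, $(\theta,u)\mapsto x_\theta(u)$, be a continuous map such that $\theta\mapsto x_\theta(u)$ is differentiable for every $u\in M$ and $\dot x:J\times M\to TM$ is continuous. Then for every $\mu\in\mathcal P_2(M)$ the function $\theta\mapsto F(\mu\circ x_\theta^{-1})$ is differentiable on $J$ (one-sidedly at endpoints of $J$ that belong to $J$), the integrand below is $\mu$-integrable, and for all $\theta\in J$ $$\frac{d}{d\theta}F(\mu\circ x_\theta^{-1})=\int_M\big\langle D_IF(\mu\circ x_\theta^{-1})(x_\theta(u)),\dot x_\theta(u)\big\rangle_{T_{x_\theta(u)}M}\,\mu(du).$$ The value of the right-hand side does not depend on the version of $D_IF(\mu\circ x_\theta^{-1})$ that is used. -/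

import Mathlib

open MeasureTheory Set Bundle
open scoped Manifold ContDiff NNReal

noncomputable section

/-- The couplings of two probability measures. -/
def couplings {M : Type*} [MeasurableSpace M] (μ ν : ProbabilityMeasure M) :
    Set (Measure (M × M)) :=
  {κ | κ.map Prod.fst = (μ : Measure M) ∧ κ.map Prod.snd = (ν : Measure M)}

/-- The Wasserstein distance of order two, as an extended nonnegative number. -/
def wasserstein2 {M : Type*} [MetricSpace M] [MeasurableSpace M] (μ ν : ProbabilityMeasure M) :
    ENNReal :=
  (⨅ κ ∈ couplings μ ν, ∫⁻ z, edist z.1 z.2 ^ 2 ∂κ) ^ (1 / 2 : ℝ)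

open Classical in
/-- The image measure `μ ∘ f⁻¹`. It is only used for continuous `f`; for a map that is not
measurable the value is the junk value `μ`. -/
def pushforward {M : Type*} [MeasurableSpace M] (f : M → M) (μ : ProbabilityMeasure M) :
    ProbabilityMeasure M :=
  if h : AEMeasurable f (μ : Measure M) then μ.map h else μ

/-- Smooth vector fields on `M`. -/
abbrev SmoothVectorField (d : ℕ) (M : Type*) [TopologicalSpace M]
    [ChartedSpace (EuclideanSpace ℝ (Fin d)) M] [IsManifold (𝓡 d) ∞ M] : Type _ :=
  ContMDiffSection (𝓡 d) (EuclideanSpace ℝ (Fin d)) ∞ (fun x : M => TangentSpace (𝓡 d) x)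

/-- `Φ` is the (global) flow of the vector field `V`. A smooth vector field on a compact manifold
has exactly one such flow. -/
def IsFlowOf {d : ℕ} {M : Type*} [TopologicalSpace M]
    [ChartedSpace (EuclideanSpace ℝ (Fin d)) M] [IsManifold (𝓡 d) ∞ M]
    (Φ : Flow ℝ M) (V : SmoothVectorField d M) : Prop :=
  ∀ x : M, IsMIntegralCurve (I := 𝓡 d) (fun t => Φ t x) (fun y => V y)

/-- `F` is intrinsically differentiable at `μ` in direction `V`, with derivative `c`:
with `Φ` the flow of `V`, the derivative of `ε ↦ F (μ ∘ Φ_ε⁻¹)` at `ε = 0` exists and equals `c`. -/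
def HasIntrinsicDerivAt {d : ℕ} {M : Type*} [TopologicalSpace M] [MeasurableSpace M]
    [ChartedSpace (EuclideanSpace ℝ (Fin d)) M] [IsManifold (𝓡 d) ∞ M]
    (F : ProbabilityMeasure M → ℝ) (μ : ProbabilityMeasure M) (V : SmoothVectorField d M)
    (c : ℝ) : Prop :=
  ∃ Φ : Flow ℝ M, IsFlowOf Φ V ∧ HasDerivAt (fun ε : ℝ => F (pushforward (Φ ε) μ)) c 0

section Riemannian

variable {d : ℕ} {M : Type*} [MetricSpace M] [MeasurableSpace M]
  [ChartedSpace (EuclideanSpace ℝ (Fin d)) M] [IsManifold (𝓡 d) ∞ M]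
  [RiemannianBundle (fun x : M => TangentSpace (𝓡 d) x)]

/-- `F` is intrinsically differentiable: at every `μ` the directional derivative exists in every
smooth direction, is linear in the direction, and is continuous for the norm of `L²(μ; TM)`. -/
def IntrinsicallyDifferentiable (d : ℕ) {M : Type*} [MetricSpace M] [MeasurableSpace M]
    [ChartedSpace (EuclideanSpace ℝ (Fin d)) M] [IsManifold (𝓡 d) ∞ M]
    [RiemannianBundle (fun x : M => TangentSpace (𝓡 d) x)]
    (F : ProbabilityMeasure M → ℝ) : Prop :=
  ∀ μ : ProbabilityMeasure M, ∃ L : SmoothVectorField d M →ₗ[ℝ] ℝ,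
    (∀ V, HasIntrinsicDerivAt F μ V (L V)) ∧
    ∃ C : ℝ, ∀ V, |L V| ≤ C * Real.sqrt (∫ x, ‖V x‖ ^ 2 ∂(μ : Measure M))

/-- The vector field `G` represents the intrinsic derivative `D_I F(μ)`: it belongs to `L²(μ; TM)`
and `D_I^V F(μ) = ∫ ⟨G, V⟩ dμ` for all smooth vector fields `V`. Such a `G` is unique up to
equality `μ`-almost everywhere. -/
structure IsIntrinsicGradient (F : ProbabilityMeasure M → ℝ) (μ : ProbabilityMeasure M)
    (G : ∀ x : M, TangentSpace (𝓡 d) x) : Prop where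
  aestronglyMeasurable :
    AEStronglyMeasurable (fun x : M => (⟨x, G x⟩ : TangentBundle (𝓡 d) M)) (μ : Measure M)
  sq_integrable : ∫⁻ x, ‖G x‖ₑ ^ 2 ∂(μ : Measure M) < ⊤
  hasIntrinsicDerivAt : ∀ V : SmoothVectorField d M,
    HasIntrinsicDerivAt F μ V (∫ x, inner ℝ (G x) (V x) ∂(μ : Measure M))

/-- The class `C^{1,1}(P₂(M))` for compact `M` (every probability measure then belongs to `P₂(M)`):
`F` is Lipschitz for the Wasserstein distance and intrinsically differentiable, and the intrinsic
derivative has a version `(μ, x) ↦ D μ x` that is a continuous vector field for every `μ` and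
Lipschitz in `μ`, uniformly in `x`. -/
structure IsC11 (d : ℕ) {M : Type*} [MetricSpace M] [MeasurableSpace M]
    [ChartedSpace (EuclideanSpace ℝ (Fin d)) M] [IsManifold (𝓡 d) ∞ M]
    [RiemannianBundle (fun x : M => TangentSpace (𝓡 d) x)]
    (F : ProbabilityMeasure M → ℝ) : Prop where
  lipschitz : ∃ C : ℝ≥0, ∀ μ ν, edist (F μ) (F ν) ≤ C * wasserstein2 μ ν
  differentiable : IntrinsicallyDifferentiable d F
  derivative : ∃ D : ProbabilityMeasure M → ∀ x : M, TangentSpace (𝓡 d) x,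
    (∀ μ, IsIntrinsicGradient F μ (D μ)) ∧
    (∀ μ, Continuous (fun x : M => (⟨x, D μ x⟩ : TangentBundle (𝓡 d) M))) ∧
    ∃ C : ℝ≥0, ∀ μ ν x, ‖D μ x - D ν x‖ₑ ≤ C * wasserstein2 μ ν

end Riemannian

end

section

open Filter Topology Manifold Asymptotics

/-! ### Riemannian distance against distance in a chart. -/

section ChartEstimate

variable {E : Type*} [NormedAddCommGroup E] [NormedSpace ℝ E]
  {H : Type*} [TopologicalSpace H] {I : ModelWithCorners ℝ E H}
  {M : Type*} [PseudoEMetricSpace M] [ChartedSpace H M]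
  [RiemannianBundle (fun x : M => TangentSpace I x)] [IsManifold I 1 M]
  [IsContinuousRiemannianBundle E (fun x : M => TangentSpace I x)]

/-! The hypothesis on `F` only gives derivatives along flows of smooth vector fields, while the
velocity of `x` need not be a function of position: trajectories may meet with different velocities.
The proof discretises the parameter `u` and then separates the trajectories.

Replace `u` by `T u` with `T` a simple function, so that only finitely many curves move. If at time
`t₀` equal positions imply equal velocities, some smooth field `V` takes these velocities at these
positions. The curves and the flow of `V` are then tangent at `t₀`, and since `F` is Lipschitz, `F`
along the curves and along the flow differ by `o(t - t₀)`. This is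
`hasDerivWithinAt_pushforward_of_injective`.

If curves collide at `t₀`, replace each by a straight line in a chart with the same tangent vector,
again at cost `o(t - t₀)`. Lines with different tangent vectors do not meet just after `t₀`, so the
formula holds there; its right-hand side converges as `t ↓ t₀` because `D` is continuous in space
and Lipschitz in the measure. A function continuous at `t₀` whose derivative has a limit from the
right has that limit as right derivative. This is `hasDerivWithinAt_Ici_pushforward_simpleFunc`.

Right derivatives suffice for the mean value inequality. Let the simple functions tend to the
identity: the derivatives converge jointly in the index and the time, so the difference quotient
estimate is uniform in the index and survives the limit. Finally, `IsIntrinsicGradient.ae_eq` allows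
any version of the gradient. -/

theorem eventually_enorm_mfderivWithin_symm_le (x : M) :
    ∃ C : ℝ≥0, ∀ᶠ y in 𝓝[range I] (extChartAt I x x), ∀ w : E,
      ‖mfderivWithin 𝓘(ℝ, E) I (extChartAt I x).symm (range I) y w‖ₑ ≤ C * ‖w‖ₑ := by
  obtain ⟨C, C_pos, hC⟩ := eventually_norm_symmL_trivializationAt_lt E
    (fun x : M => TangentSpace I x) x
  lift C to ℝ≥0 using C_pos.le
  refine ⟨C, ?_⟩
  have h1 : ∀ᶠ y in 𝓝 x, ∀ w : E,
      ‖mfderivWithin 𝓘(ℝ, E) I (extChartAt I x).symm (range I) (extChartAt I x y) w‖ₑ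
        ≤ C * ‖w‖ₑ := by
    have hx : (chartAt H x).source ∈ 𝓝 x := chart_source_mem_nhds H x
    filter_upwards [hC, hx] with y hy h'y w
    have := ContinuousLinearMap.le_of_opNorm_le _ hy.le w
    -- The derivative of the inverse chart is the inverse of the tangent trivialization, whose norm
    -- is locally bounded for a continuous metric.
    rw [TangentBundle.symmL_trivializationAt h'y] at this
    have key : ∀ p, p = y → ∀ v : E,
        ‖(id v : TangentSpace I p)‖ = ‖(id v : TangentSpace I y)‖ := by
      rintro _ rfl v; rfl
    have A : (extChartAt I x).symm (extChartAt I x y) = y :=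
      (extChartAt I x).left_inv (by simpa using h'y)
    have h2 := (key _ A _).trans_le this
    rw [enorm_eq_nnnorm, enorm_eq_nnnorm]
    exact_mod_cast h2
  have : 𝓝 x = 𝓝 ((extChartAt I x).symm (extChartAt I x x)) := by simp
  rw [this] at h1
  have : ContinuousAt (extChartAt I x).symm (extChartAt I x x) := continuousAt_extChartAt_symm _
  filter_upwards [nhdsWithin_le_nhds (this.preimage_mem_nhds h1),
    extChartAt_target_mem_nhdsWithin x] with y hy h'y w
  have e := (extChartAt I x).right_inv h'y
  have := hy w
  rwa [e] at this

/-- The inverse of a chart is locally Lipschitz for the Riemannian distance. -/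
theorem exists_edist_le_edist_extChartAt [IsRiemannianManifold I M] (x : M) :
    ∃ C : ℝ≥0, ∀ᶠ z : M × M in 𝓝 (x, x),
      edist z.1 z.2 ≤ C * edist (extChartAt I x z.1) (extChartAt I x z.2) := by
  obtain ⟨C, hC⟩ := eventually_enorm_mfderivWithin_symm_le (I := I) x
  refine ⟨C, ?_⟩
  obtain ⟨r, r_pos, hr⟩ : ∃ r > 0,
      Metric.ball (extChartAt I x x) r ∩ range I ⊆ (extChartAt I x).target ∩
        {y | ∀ w : E,
          ‖mfderivWithin 𝓘(ℝ, E) I (extChartAt I x).symm (range I) y w‖ₑ ≤ C * ‖w‖ₑ} :=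
    Metric.mem_nhdsWithin_iff.1 (inter_mem (extChartAt_target_mem_nhdsWithin x) hC)
  have A : (extChartAt I x) ⁻¹' (Metric.ball (extChartAt I x x) r ∩ range I) ∈ 𝓝 x := by
    apply extChartAt_preimage_mem_nhds_of_mem_nhdsWithin (by simp)
    rw [inter_comm]
    exact inter_mem_nhdsWithin _ (Metric.ball_mem_nhds _ r_pos)
  have B := inter_mem A (extChartAt_source_mem_nhds (I := I) x)
  rw [nhds_prod_eq]
  filter_upwards [prod_mem_prod B B] with z hz
  obtain ⟨⟨hy, hy'⟩, ⟨hz, hz'⟩⟩ := hz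
  -- The competitor for the distance is the inverse chart image of the segment, which stays in a
  -- convex set where the derivative bound `C` holds.
  let η := ContinuousAffineMap.lineMap (R := ℝ) (extChartAt I x z.1) (extChartAt I x z.2)
  set γ := (extChartAt I x).symm ∘ η
  have hη : Icc 0 1 ⊆ ⇑η ⁻¹' ((extChartAt I x).target ∩
        {y | ∀ w : E,
          ‖mfderivWithin 𝓘(ℝ, E) I (extChartAt I x).symm (range I) y w‖ₑ ≤ C * ‖w‖ₑ}) := by
    simp only [← image_subset_iff, ContinuousAffineMap.coe_lineMap_eq,
     ← segment_eq_image_lineMap, η]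
    apply Subset.trans _ hr
    exact ((convex_ball _ _).inter I.convex_range).segment_subset hy hz
  simp only [preimage_inter, subset_inter_iff] at hη
  have η_smooth : CMDiff[Icc 0 1] 1 η := by
    apply ContMDiff.contMDiffOn
    rw [contMDiff_iff_contDiff]
    exact ContinuousAffineMap.contDiff _
  rw [IsRiemannianManifold.out (I := I) z.1 z.2]
  have : riemannianEDist I z.1 z.2 ≤ pathELength I γ 0 1 := by
    apply riemannianEDist_le_pathELength _ _ _ zero_le_one
    · exact (contMDiffOn_extChartAt_symm x).comp η_smooth hη.1
    · simp only [γ, η, ContinuousAffineMap.coe_lineMap_eq, Function.comp, AffineMap.lineMap_apply_zero]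
      exact (extChartAt I x).left_inv hy'
    · simp only [γ, η, ContinuousAffineMap.coe_lineMap_eq, Function.comp, AffineMap.lineMap_apply_one]
      exact (extChartAt I x).left_inv hz'
  apply this.trans
  rw [← lintegral_fderiv_lineMap_eq_edist, pathELength_eq_lintegral_mfderivWithin_Icc,
    ← lintegral_const_mul' _ _ ENNReal.coe_ne_top]
  apply setLIntegral_mono' measurableSet_Icc (fun t ht ↦ ?_)
  have : mfderiv[Icc 0 1] γ t =
      (mfderivWithin 𝓘(ℝ, E) I (extChartAt I x).symm (range I) (η t)) ∘L (mfderiv[Icc 0 1] η t) := by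
    apply mfderivWithin_comp
    · exact mdifferentiableWithinAt_extChartAt_symm (hη.1 ht)
    · exact η_smooth.mdifferentiableOn one_ne_zero t ht
    · exact hη.1.trans (preimage_mono (extChartAt_target_subset_range x))
    · rw [uniqueMDiffWithinAt_iff_uniqueDiffWithinAt]
      exact uniqueDiffOn_Icc zero_lt_one t ht
  have : mfderiv[Icc 0 1] γ t 1 =
      (mfderivWithin 𝓘(ℝ, E) I (extChartAt I x).symm (range I) (η t)) (mfderiv[Icc 0 1] η t 1) :=
    congr($this 1)
  rw [this]
  refine (hη.2 ht _).trans ?_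
  simp only [mfderivWithin_eq_fderivWithin]
  exact le_rfl

end ChartEstimate

theorem isContinuousRiemannianBundle_tangentSpace (d : ℕ) (M : Type*) [MetricSpace M]
    [ChartedSpace (EuclideanSpace ℝ (Fin d)) M] [IsManifold (𝓡 d) ∞ M]
    [RiemannianBundle (fun x : M => TangentSpace (𝓡 d) x)]
    [h : IsContMDiffRiemannianBundle (𝓡 d) ∞ (EuclideanSpace ℝ (Fin d))
      (fun x : M => TangentSpace (𝓡 d) x)] :
    IsContinuousRiemannianBundle (EuclideanSpace ℝ (Fin d))
      (fun x : M => TangentSpace (𝓡 d) x) := by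
  obtain ⟨g, hg, hg'⟩ := h.exists_contMDiff
  exact ⟨g, hg.continuous, hg'⟩

/-! ### Velocities of curves, and straight lines in charts. -/

section Curves

variable {E : Type*} [NormedAddCommGroup E] [NormedSpace ℝ E]
  {H : Type*} [TopologicalSpace H] {I : ModelWithCorners ℝ E H}

theorem hasMFDerivWithinAt_curve_iff {M : Type*} [TopologicalSpace M] [ChartedSpace H M]
    {c : ℝ → M} {S : Set ℝ} {t₀ : ℝ} {v : TangentSpace I (c t₀)} :
    HasMFDerivWithinAt 𝓘(ℝ, ℝ) I c S t₀ ((1 : ℝ →L[ℝ] ℝ).smulRight v) ↔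
      ContinuousWithinAt c S t₀ ∧
        HasDerivWithinAt (fun t => extChartAt I (c t₀) (c t)) (id v : E) S t₀ := by
  simp only [HasMFDerivWithinAt, hasDerivWithinAt_iff_hasFDerivWithinAt, writtenInExtChartAt]
  simp only [mfld_simps]
  rfl

/-- Base points often agree only propositionally, so vectors are compared in the model space `E`, to
which every `TangentSpace` unfolds. -/
theorem vector_eq_of_mk_eq {M : Type*} [TopologicalSpace M] [ChartedSpace H M] {a b : M}
    {v : TangentSpace I a} {w : TangentSpace I b}
    (h : (⟨a, v⟩ : TangentBundle I M) = ⟨b, w⟩) : (id v : E) = id w := by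
  cases h
  rfl

/-- Two curves that are tangent at a common point are close to first order. -/
theorem isLittleO_dist_of_hasMFDerivWithinAt
    {M : Type*} [PseudoMetricSpace M] [ChartedSpace H M]
    [RiemannianBundle (fun x : M => TangentSpace I x)] [IsManifold I 1 M]
    [IsContinuousRiemannianBundle E (fun x : M => TangentSpace I x)] [IsRiemannianManifold I M]
    {c₁ c₂ : ℝ → M} {S : Set ℝ} {t₀ : ℝ}
    {v₁ : TangentSpace I (c₁ t₀)} {v₂ : TangentSpace I (c₂ t₀)}
    (h₁ : HasMFDerivWithinAt 𝓘(ℝ, ℝ) I c₁ S t₀ ((1 : ℝ →L[ℝ] ℝ).smulRight v₁))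
    (h₂ : HasMFDerivWithinAt 𝓘(ℝ, ℝ) I c₂ S t₀ ((1 : ℝ →L[ℝ] ℝ).smulRight v₂))
    (h : (⟨c₁ t₀, v₁⟩ : TangentBundle I M) = ⟨c₂ t₀, v₂⟩) :
    (fun t => dist (c₁ t) (c₂ t)) =o[𝓝[S] t₀] fun t => t - t₀ := by
  rw [hasMFDerivWithinAt_curve_iff] at h₁ h₂
  obtain ⟨k₁, d₁⟩ := h₁
  obtain ⟨k₂, d₂⟩ := h₂
  obtain ⟨x, hx⟩ : ∃ x, c₁ t₀ = x := ⟨_, rfl⟩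
  have hx₂ : c₂ t₀ = x := by rw [← hx]; exact (congrArg TotalSpace.proj h).symm
  have hv : (id v₁ : E) = id v₂ := vector_eq_of_mk_eq h
  rw [hv] at d₁
  rw [hx] at d₁
  rw [hx₂] at d₂
  have key : ∀ (w : E) (f g : ℝ → E), HasDerivWithinAt f w S t₀ → HasDerivWithinAt g w S t₀ →
      f t₀ = g t₀ → (fun t => f t - g t) =o[𝓝[S] t₀] fun t => t - t₀ := by
    intro w f g hf hg hfg
    simpa [hfg] using hasDerivWithinAt_iff_isLittleO.1 (hf.sub hg)
  have hd := key _ _ _ d₁ d₂ (by rw [hx, hx₂])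
  obtain ⟨C, hC⟩ := exists_edist_le_edist_extChartAt (I := I) x
  have hk : Tendsto (fun t => (c₁ t, c₂ t)) (𝓝[S] t₀) (𝓝 (x, x)) := by
    rw [nhds_prod_eq]
    refine Tendsto.prodMk ?_ ?_
    · rw [← hx]; exact k₁
    · rw [← hx₂]; exact k₂
  refine IsBigO.trans_isLittleO (IsBigO.of_bound C ?_) hd
  filter_upwards [hk.eventually hC] with t ht
  rw [Real.norm_of_nonneg dist_nonneg, ← dist_eq_norm]
  rw [edist_nndist, edist_nndist] at ht
  rw [← coe_nndist, ← coe_nndist]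
  exact_mod_cast ht

variable {M : Type*} [TopologicalSpace M] [ChartedSpace H M]

/-- The curve that starts at the base point of `p` and is a straight line with velocity `p` in
the chart there. -/
noncomputable def chartLine (p : TangentBundle I M) (t : ℝ) : M :=
  (extChartAt I p.1).symm (extChartAt I p.1 p.1 + t • (id p.2 : E))

@[simp]
theorem chartLine_zero (p : TangentBundle I M) : chartLine p 0 = p.1 := by
  simp [chartLine]

theorem eventually_mem_extChartAt_target [I.Boundaryless] (p : TangentBundle I M) :
    ∀ᶠ t : ℝ in 𝓝 0, extChartAt I p.1 p.1 + t • (id p.2 : E) ∈ (extChartAt I p.1).target := by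
  have : ContinuousAt (fun t : ℝ => extChartAt I p.1 p.1 + t • (id p.2 : E)) 0 := by fun_prop
  apply this.eventually_mem
  simpa using extChartAt_target_mem_nhds (I := I) p.1

variable [IsManifold I 1 M] [I.Boundaryless]

theorem contMDiffAt_chartLine (p : TangentBundle I M) :
    ContMDiffAt 𝓘(ℝ, ℝ) I 1 (chartLine p) 0 := by
  have h : ContMDiffAt 𝓘(ℝ, ℝ) 𝓘(ℝ, E) 1
      (fun t : ℝ => extChartAt I p.1 p.1 + t • (id p.2 : E)) 0 := by
    rw [contMDiffAt_iff_contDiffAt]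
    fun_prop
  have h2 : ContMDiffAt 𝓘(ℝ, E) I 1 (extChartAt I p.1).symm
      (extChartAt I p.1 p.1 + (0 : ℝ) • (id p.2 : E)) := by
    rw [zero_smul, add_zero]
    exact (contMDiffOn_extChartAt_symm p.1).contMDiffAt (extChartAt_target_mem_nhds p.1)
  exact h2.comp (0 : ℝ) h

theorem hasMFDerivAt_chartLine_zero (p : TangentBundle I M)
    {v : TangentSpace I (chartLine p 0)} (hv : (⟨chartLine p 0, v⟩ : TangentBundle I M) = p) :
    HasMFDerivAt 𝓘(ℝ, ℝ) I (chartLine p) 0 ((1 : ℝ →L[ℝ] ℝ).smulRight v) := by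
  have hv' : (id v : E) = id p.2 := vector_eq_of_mk_eq hv
  refine hasMFDerivWithinAt_univ.1 (hasMFDerivWithinAt_curve_iff.2 ⟨?_, ?_⟩)
  · exact (contMDiffAt_chartLine p).continuousAt.continuousWithinAt
  · rw [hasDerivWithinAt_univ, chartLine_zero, hv']
    have h : HasDerivAt (fun t : ℝ => extChartAt I p.1 p.1 + t • (id p.2 : E)) (id p.2 : E) 0 := by
      simpa using ((hasDerivAt_id (0 : ℝ)).smul_const (id p.2 : E)).const_add (extChartAt I p.1 p.1)
    refine h.congr_of_eventuallyEq ?_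
    filter_upwards [eventually_mem_extChartAt_target p] with t ht
    exact (extChartAt I p.1).right_inv ht

/-- The line is C¹ near time zero, so its tangent map is continuous there. The convergence of
velocities is what later gives a limit of derivatives. -/
theorem exists_velocity_chartLine (p : TangentBundle I M) :
    ∃ v : ∀ t, TangentSpace I (chartLine p t),
      (∀ᶠ t in 𝓝 0, HasMFDerivAt 𝓘(ℝ, ℝ) I (chartLine p) t ((1 : ℝ →L[ℝ] ℝ).smulRight (v t))) ∧
      (⟨chartLine p 0, v 0⟩ : TangentBundle I M) = p ∧
      Tendsto (fun t => (⟨chartLine p t, v t⟩ : TangentBundle I M)) (𝓝 0) (𝓝 p) := by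
  have h3 : (⟨chartLine p 0, mfderiv 𝓘(ℝ, ℝ) I (chartLine p) 0 (1 : ℝ)⟩ :
      TangentBundle I M) = p := by
    obtain ⟨v, hv⟩ : ∃ v : TangentSpace I (chartLine p 0),
        (⟨chartLine p 0, v⟩ : TangentBundle I M) = p := by
      have : ∀ a : M, a = p.1 → ∃ v : TangentSpace I a, (⟨a, v⟩ : TangentBundle I M) = p := by
        rintro _ rfl
        exact ⟨p.2, rfl⟩
      exact this _ (chartLine_zero p)
    rw [(hasMFDerivAt_chartLine_zero p hv).mfderiv]
    refine Eq.trans ?_ hv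
    congr 1
    exact one_smul ℝ v
  refine ⟨fun t => mfderiv 𝓘(ℝ, ℝ) I (chartLine p) t (1 : ℝ), ?_, h3, ?_⟩
  · filter_upwards [(contMDiffAt_iff_contMDiffAt_nhds (by simp)).1 (contMDiffAt_chartLine p)]
      with t ht
    refine (ht.mdifferentiableAt one_ne_zero).hasMFDerivAt.congr_mfderiv ?_
    exact ContinuousLinearMap.ext_ring (one_smul ℝ _).symm
  · obtain ⟨U, hU, hl⟩ : ∃ U ∈ 𝓝 (0 : ℝ), ContMDiffOn 𝓘(ℝ, ℝ) I 1 (chartLine p) U :=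
      (contMDiffAt_iff_contMDiffOn_nhds (by simp)).1 (contMDiffAt_chartLine p)
    obtain ⟨W, hWU, hW, h0⟩ := mem_nhds_iff.1 hU
    have hc := (hl.mono hWU).continuousOn_tangentMapWithin le_rfl hW.uniqueMDiffOn
    have hs : Continuous (fun t : ℝ => (⟨t, (1 : ℝ)⟩ : TangentBundle 𝓘(ℝ, ℝ) ℝ)) := by
      exact (tangentBundleModelSpaceHomeomorph 𝓘(ℝ, ℝ)).symm.continuous.comp
        (continuous_id.prodMk continuous_const)
    have hc' := hc.comp hs.continuousOn (s := W) (fun t ht => ht)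
    have h2 : ContinuousAt (fun t => (⟨chartLine p t, mfderiv 𝓘(ℝ, ℝ) I (chartLine p) t (1 : ℝ)⟩ :
        TangentBundle I M)) 0 := by
      refine (hc'.continuousAt (hW.mem_nhds h0)).congr ?_
      filter_upwards [hW.mem_nhds h0] with t ht
      simp only [Function.comp, tangentMapWithin, mfderivWithin_of_isOpen hW ht]
    have := h2.tendsto
    rwa [h3] at this

/-- Over one base point both lines live in the same chart and differ there by `t • (v - w)`; over
distinct base points, continuity and the Hausdorff property separate them. -/
theorem eventually_chartLine_ne [T2Space M] {p q : TangentBundle I M} (hpq : p ≠ q) :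
    ∀ᶠ t in 𝓝[≠] (0 : ℝ), chartLine p t ≠ chartLine q t := by
  by_cases h : p.1 = q.1
  · obtain ⟨x, v⟩ := p
    obtain ⟨y, w⟩ := q
    obtain rfl : x = y := h
    filter_upwards [nhdsWithin_le_nhds (eventually_mem_extChartAt_target ⟨x, v⟩),
      nhdsWithin_le_nhds (eventually_mem_extChartAt_target ⟨x, w⟩), self_mem_nhdsWithin]
      with t h1 h2 ht heq
    have h3 := (extChartAt I x).symm.injOn h1 h2 heq
    have h4 : (id v : E) = id w := smul_right_injective E (by simpa using ht) (add_left_cancel h3)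
    exact hpq (congrArg (TotalSpace.mk x) h4)
  · have hp := (contMDiffAt_chartLine p).continuousAt.tendsto
    have hq := (contMDiffAt_chartLine q).continuousAt.tendsto
    rw [chartLine_zero] at hp hq
    obtain ⟨U, W, hU, hW, hpU, hqW, hd⟩ := t2_separation h
    filter_upwards [nhdsWithin_le_nhds (hp (hU.mem_nhds hpU)),
      nhdsWithin_le_nhds (hq (hW.mem_nhds hqW))] with t h1 h2
    exact hd.ne_of_mem h1 h2

end Curves

/-! ### Interpolation by smooth fields, and uniqueness of the gradient. -/

section VectorFields

variable {d : ℕ}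

/-- Prescribing a value at a point is a convex condition on the fibre, so a partition of unity glues
local solutions. Near `x₀` all other prescribed points can be avoided, as they are finitely many. -/
theorem exists_smoothVectorField_eq {M : Type*} [TopologicalSpace M] [CompactSpace M] [T2Space M]
    [ChartedSpace (EuclideanSpace ℝ (Fin d)) M] [IsManifold (𝓡 d) ∞ M]
    {P : Set (TangentBundle (𝓡 d) M)} (hP : P.Finite)
    (hinj : ∀ p ∈ P, ∀ q ∈ P, p.1 = q.1 → p = q) :
    ∃ V : SmoothVectorField d M, ∀ p ∈ P, V p.1 = p.2 := by
  suffices h : ∃ V : SmoothVectorField d M, ∀ x, V x ∈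
      {w : TangentSpace (𝓡 d) x | ∀ p ∈ P, p.1 = x → (⟨x, w⟩ : TangentBundle (𝓡 d) M) = p} by
    obtain ⟨V, hV⟩ := h
    refine ⟨V, fun p hp => ?_⟩
    have h : (id (V p.1) : EuclideanSpace ℝ (Fin d)) = id p.2 :=
      vector_eq_of_mk_eq (I := 𝓡 d) (v := V p.1) (w := p.2) (hV p.1 p hp rfl)
    exact h
  refine exists_contMDiffSection_forall_mem_convex_of_local (𝓡 d) (n := ⊤)
    (F_fiber := EuclideanSpace ℝ (Fin d)) (fun x : M => TangentSpace (𝓡 d) x) _ ?_ ?_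
  · intro x v hv w hw a b ha hb hab p hp hpx
    have h : (id v : EuclideanSpace ℝ (Fin d)) = id w :=
      vector_eq_of_mk_eq ((hv p hp hpx).trans (hw p hp hpx).symm)
    have h' : v = w := h
    rw [← h', ← add_smul, hab, one_smul]
    exact hv p hp hpx
  · intro x₀
    have hfin : (P.image TotalSpace.proj \ {x₀}).Finite := (hP.image _).sdiff
    have hN : (trivializationAt (EuclideanSpace ℝ (Fin d)) (TangentSpace (𝓡 d)) x₀).baseSet ∩
        (P.image TotalSpace.proj \ {x₀})ᶜ ∈ 𝓝 x₀ :=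
      inter_mem ((trivializationAt _ _ x₀).open_baseSet.mem_nhds
        (FiberBundle.mem_baseSet_trivializationAt' x₀))
        (hfin.isClosed.isOpen_compl.mem_nhds (by simp))
    have hs : ∀ w : EuclideanSpace ℝ (Fin d), ContMDiffOn (𝓡 d)
        ((𝓡 d).prod 𝓘(ℝ, EuclideanSpace ℝ (Fin d))) ∞
        (fun y => (⟨y, (trivializationAt (EuclideanSpace ℝ (Fin d)) (TangentSpace (𝓡 d)) x₀).symm
          y w⟩ : TangentBundle (𝓡 d) M))
        (trivializationAt (EuclideanSpace ℝ (Fin d)) (TangentSpace (𝓡 d)) x₀).baseSet := by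
      intro w
      rw [Bundle.Trivialization.contMDiffOn_section_baseSet_iff]
      refine contMDiffOn_const (c := w) |>.congr fun y hy => ?_
      exact (congrArg Prod.snd (Bundle.Trivialization.apply_mk_symm _ hy w)).symm ▸ rfl
    refine ⟨_, hN, ?_⟩
    obtain ⟨v, hv⟩ : ∃ v : TangentSpace (𝓡 d) x₀, ∀ p ∈ P, p.1 = x₀ →
        (⟨x₀, v⟩ : TangentBundle (𝓡 d) M) = p := by
      by_cases h : ∃ p ∈ P, p.1 = x₀
      · obtain ⟨p, hp, rfl⟩ := h
        exact ⟨p.2, fun q hq hqp => hinj p hp q hq hqp.symm⟩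
      · exact ⟨0, fun p hp hpx => (h ⟨p, hp, hpx⟩).elim⟩
    refine ⟨FiberBundle.extend _ v, (hs _).mono inter_subset_left, ?_⟩
    rintro y ⟨-, hy⟩ p hp rfl
    have hpx : p.1 = x₀ := by
      by_contra hne
      exact hy ⟨⟨p, hp, rfl⟩, hne⟩
    have := hv p hp hpx
    subst hpx
    rw [FiberBundle.extend_apply_self]
    exact this

theorem isFlowOf_unique {M : Type*} [TopologicalSpace M] [T2Space M]
    [ChartedSpace (EuclideanSpace ℝ (Fin d)) M] [IsManifold (𝓡 d) ∞ M]
    {Φ Ψ : Flow ℝ M} {V : SmoothVectorField d M} (hΦ : IsFlowOf Φ V) (hΨ : IsFlowOf Ψ V)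
    (t : ℝ) (x : M) : Φ t x = Ψ t x := by
  have := isMIntegralCurve_Ioo_eq_of_contMDiff_boundaryless (t₀ := 0)
    (V.contMDiff.of_le (by norm_cast)) (hΦ x) (hΨ x) (by simp)
  exact congrFun this t

/-- The flow is existentially quantified, so uniqueness of the derivative rests on uniqueness of
integral curves. -/
theorem HasIntrinsicDerivAt.unique {M : Type*} [TopologicalSpace M] [T2Space M]
    [MeasurableSpace M]
    [ChartedSpace (EuclideanSpace ℝ (Fin d)) M] [IsManifold (𝓡 d) ∞ M]
    {F : ProbabilityMeasure M → ℝ} {μ : ProbabilityMeasure M} {V : SmoothVectorField d M}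
    {a b : ℝ} (ha : HasIntrinsicDerivAt F μ V a) (hb : HasIntrinsicDerivAt F μ V b) : a = b := by
  obtain ⟨Φ, hΦ, ha⟩ := ha
  obtain ⟨Ψ, hΨ, hb⟩ := hb
  have : ∀ t, (Φ t : M → M) = Ψ t := fun t => funext (isFlowOf_unique hΦ hΨ t)
  simp only [this] at ha
  exact ha.unique hb

variable {M : Type*} [MetricSpace M]
  [ChartedSpace (EuclideanSpace ℝ (Fin d)) M] [IsManifold (𝓡 d) ∞ M]
  [RiemannianBundle (fun x : M => TangentSpace (𝓡 d) x)]
  [IsContMDiffRiemannianBundle (𝓡 d) ∞ (EuclideanSpace ℝ (Fin d))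
    (fun x : M => TangentSpace (𝓡 d) x)]

theorem continuous_inner_section {V : ∀ x : M, TangentSpace (𝓡 d) x}
    (hV : Continuous fun x => (⟨x, V x⟩ : TangentBundle (𝓡 d) M)) :
    Continuous fun p : TangentBundle (𝓡 d) M => inner ℝ (V p.1) p.2 := by
  have := isContinuousRiemannianBundle_tangentSpace d M
  refine Continuous.inner_bundle (F := EuclideanSpace ℝ (Fin d))
    (E := fun x : M => TangentSpace (𝓡 d) x) (b := fun p : TangentBundle (𝓡 d) M => p.1)
    (hV.comp (FiberBundle.continuous_proj _ _)) continuous_id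

theorem continuous_norm_tangentBundle :
    Continuous fun p : TangentBundle (𝓡 d) M => ‖p.2‖ := by
  have := isContinuousRiemannianBundle_tangentSpace d M
  have h : Continuous fun p : TangentBundle (𝓡 d) M => inner ℝ p.2 p.2 :=
    Continuous.inner_bundle (F := EuclideanSpace ℝ (Fin d))
      (E := fun x : M => TangentSpace (𝓡 d) x) (b := fun p : TangentBundle (𝓡 d) M => p.1)
      continuous_id continuous_id
  simp only [norm_eq_sqrt_real_inner]
  exact Real.continuous_sqrt.comp h

theorem exists_norm_section_le [CompactSpace M] {V : ∀ x : M, TangentSpace (𝓡 d) x}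
    (hV : Continuous fun x => (⟨x, V x⟩ : TangentBundle (𝓡 d) M)) :
    ∃ B, 0 ≤ B ∧ ∀ x, ‖V x‖ ≤ B := by
  obtain ⟨B, hB⟩ := isCompact_univ.exists_bound_of_continuousOn
    (continuous_norm_tangentBundle.comp hV).continuousOn
  refine ⟨max B 0, le_max_right _ _, fun x => ?_⟩
  have := hB x (mem_univ x)
  rw [Function.comp_apply, norm_norm] at this
  exact this.trans (le_max_left _ _)

variable [CompactSpace M] [MeasurableSpace M]

theorem IsIntrinsicGradient.integrable_inner {F : ProbabilityMeasure M → ℝ}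
    {ν : ProbabilityMeasure M} {G : ∀ x : M, TangentSpace (𝓡 d) x}
    (hG : IsIntrinsicGradient F ν G) {V : ∀ x : M, TangentSpace (𝓡 d) x}
    (hV : Continuous fun x => (⟨x, V x⟩ : TangentBundle (𝓡 d) M)) :
    Integrable (fun x => inner ℝ (G x) (V x)) (ν : Measure M) := by
  obtain ⟨B, hB0, hB⟩ := exists_norm_section_le hV
  have hn := Continuous.comp_aestronglyMeasurable
    (continuous_norm_tangentBundle (d := d) (M := M)) hG.aestronglyMeasurable
  change AEStronglyMeasurable (fun x => ‖G x‖) (ν : Measure M) at hn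
  have hsq : Integrable (fun x => ‖G x‖ ^ 2) (ν : Measure M) := by
    refine ⟨hn.pow 2, ?_⟩
    refine lt_of_le_of_lt (lintegral_mono fun x => ?_) hG.sq_integrable
    rw [enorm_pow, enorm_norm]
  have hm := Continuous.comp_aestronglyMeasurable (continuous_inner_section hV)
    hG.aestronglyMeasurable
  change AEStronglyMeasurable (fun x => inner ℝ (V x) (G x)) (ν : Measure M) at hm
  have hm' : AEStronglyMeasurable (fun x => inner ℝ (G x) (V x)) (ν : Measure M) := by
    simpa only [real_inner_comm] using hm
  have hb : ∀ a b : ℝ, 0 ≤ a → 0 ≤ b → b ≤ B → a * b ≤ a ^ 2 + B ^ 2 := by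
    intro a b ha hb hbB
    nlinarith [sq_nonneg (a - b)]
  refine Integrable.mono' (g := fun x => ‖G x‖ ^ 2 + B ^ 2) (hsq.add (integrable_const (B ^ 2)))
    hm' (ae_of_all _ fun x => ?_)
  exact (norm_inner_le_norm _ _).trans (hb _ _ (norm_nonneg _) (norm_nonneg _) (hB x))

variable [BorelSpace M]

/-- Testing with `g • V` for every smooth `g` reduces this to the fundamental lemma of the calculus
of variations for scalar functions. -/
theorem IsIntrinsicGradient.inner_ae_eq {F : ProbabilityMeasure M → ℝ}
    {ν : ProbabilityMeasure M} {G D : ∀ x : M, TangentSpace (𝓡 d) x}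
    (hG : IsIntrinsicGradient F ν G) (hD : IsIntrinsicGradient F ν D) (V : SmoothVectorField d M) :
    ∀ᵐ x ∂(ν : Measure M), inner ℝ (G x) (V x) = inner ℝ (D x) (V x) := by
  have hV : Continuous fun x => (⟨x, V x⟩ : TangentBundle (𝓡 d) M) := V.contMDiff.continuous
  refine ae_eq_of_integral_contMDiff_smul_eq (𝓡 d) (hG.integrable_inner hV).locallyIntegrable
    (hD.integrable_inner hV).locallyIntegrable fun g hg _ => ?_
  let W : SmoothVectorField d M := ⟨fun x => g x • V x, hg.smul_section V.contMDiff⟩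
  have := (hG.hasIntrinsicDerivAt W).unique (hD.hasIntrinsicDerivAt W)
  have hW : ∀ x, W x = g x • V x := fun _ => rfl
  simpa only [hW, inner_smul_right, smul_eq_mul] using this

/-- The intrinsic gradient is unique up to a null set. -/
theorem IsIntrinsicGradient.ae_eq {F : ProbabilityMeasure M → ℝ}
    {ν : ProbabilityMeasure M} {G D : ∀ x : M, TangentSpace (𝓡 d) x}
    (hG : IsIntrinsicGradient F ν G) (hD : IsIntrinsicGradient F ν D) :
    ∀ᵐ x ∂(ν : Measure M), G x = D x := by
  refine measure_null_of_locally_null _ fun x₀ _ => ?_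
  let e := trivializationAt (EuclideanSpace ℝ (Fin d)) (TangentSpace (𝓡 d) (M := M)) x₀
  let b := (EuclideanSpace.basisFun (Fin d) ℝ).toBasis
  obtain ⟨f⟩ : Nonempty (SmoothBumpFunction (𝓡 d) x₀) := inferInstance
  have hV : ∀ i, ContMDiff (𝓡 d) ((𝓡 d).prod 𝓘(ℝ, EuclideanSpace ℝ (Fin d))) ∞
      -- A local frame cut off by a bump function is globally smooth, and is still a basis of the
      -- fibre where the bump equals one.
      (fun x => (⟨x, (⇑f • e.localFrame b i) x⟩ : TangentBundle (𝓡 d) M)) := fun i =>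
    ContMDiffOn.smul_section_of_tsupport f.contMDiff.contMDiffOn e.open_baseSet
      f.tsupport_subset_chartAt_source (e.contMDiffOn_localFrame_baseSet ∞ b i)
  have hae : ∀ᵐ x ∂(ν : Measure M), ∀ i, inner ℝ (G x) ((⇑f • e.localFrame b i) x) =
      inner ℝ (D x) ((⇑f • e.localFrame b i) x) :=
    ae_all_iff.2 fun i => hG.inner_ae_eq hD ⟨_, hV i⟩
  refine ⟨{x | ¬ G x = D x} ∩ ({x | f x = 1} ∩ e.baseSet),
    inter_mem_nhdsWithin _ (inter_mem f.eventuallyEq_one (e.open_baseSet.mem_nhds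
      (FiberBundle.mem_baseSet_trivializationAt' x₀))), ?_⟩
  refine measure_mono_null ?_ (ae_iff.1 hae)
  rintro x ⟨hne, hfx, hx⟩ hall
  refine hne (InnerProductSpace.ext_inner_right_basis (e.basisAt b hx) fun i => ?_)
  have := hall i
  have hfx' : f x = 1 := hfx
  rw [Pi.smul_apply', hfx', one_smul, e.localFrame_apply_of_mem_baseSet b hx] at this
  exact this

end VectorFields

/-! ### Image measures and the Wasserstein distance. -/

section Wasserstein

theorem coe_pushforward {M : Type*} [MeasurableSpace M] {f : M → M} {μ : ProbabilityMeasure M}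
    (hf : AEMeasurable f (μ : Measure M)) :
    (pushforward f μ : Measure M) = (μ : Measure M).map f := by
  rw [pushforward, dif_pos hf]
  exact ProbabilityMeasure.toMeasure_map μ hf

theorem pushforward_pushforward {M : Type*} [MeasurableSpace M] {f g : M → M}
    {μ : ProbabilityMeasure M} (hg : Measurable g) (hf : AEMeasurable f (μ : Measure M)) :
    pushforward g (pushforward f μ) = pushforward (fun u => g (f u)) μ := by
  apply Subtype.ext
  change (pushforward g (pushforward f μ) : Measure M) = (pushforward (fun u => g (f u)) μ :)
  rw [coe_pushforward hg.aemeasurable, coe_pushforward hf,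
    coe_pushforward (f := fun u => g (f u)) (hg.comp_aemeasurable hf),
    AEMeasurable.map_map_of_aemeasurable hg.aemeasurable hf]
  rfl

variable {M : Type*} [MetricSpace M] [CompactSpace M] [MeasurableSpace M] [BorelSpace M]
  {μ : ProbabilityMeasure M}

/-- The image of `μ` under `u ↦ (f u, g u)` is a coupling. -/
theorem wasserstein2_pushforward_le {f g : M → M} (hf : AEMeasurable f (μ : Measure M))
    (hg : AEMeasurable g (μ : Measure M)) :
    wasserstein2 (pushforward f μ) (pushforward g μ) ≤
      (∫⁻ u, edist (f u) (g u) ^ 2 ∂(μ : Measure M)) ^ (1 / 2 : ℝ) := by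
  have hm : Measurable fun z : M × M => edist z.1 z.2 ^ 2 := by fun_prop
  have hfg := hf.prodMk hg
  rw [wasserstein2, ← lintegral_map' (μ := (μ : Measure M)) hm.aemeasurable hfg]
  refine ENNReal.rpow_le_rpow (iInf₂_le _ ⟨?_, ?_⟩) (by norm_num)
  · rw [coe_pushforward hf, AEMeasurable.map_map_of_aemeasurable measurable_fst.aemeasurable hfg]
    rfl
  · rw [coe_pushforward hg, AEMeasurable.map_map_of_aemeasurable measurable_snd.aemeasurable hfg]
    rfl

theorem wasserstein2_pushforward_le_of_edist_le {f g : M → M}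
    (hf : AEMeasurable f (μ : Measure M)) (hg : AEMeasurable g (μ : Measure M)) {δ : ENNReal}
    (h : ∀ u, edist (f u) (g u) ≤ δ) :
    wasserstein2 (pushforward f μ) (pushforward g μ) ≤ δ := by
  refine (wasserstein2_pushforward_le hf hg).trans ?_
  calc (∫⁻ u, edist (f u) (g u) ^ 2 ∂(μ : Measure M)) ^ (1 / 2 : ℝ)
      ≤ (∫⁻ _, δ ^ 2 ∂(μ : Measure M)) ^ (1 / 2 : ℝ) := by gcongr with u; exact h u
    _ = δ := by
      rw [lintegral_const, measure_univ, mul_one, ← ENNReal.rpow_natCast, ← ENNReal.rpow_mul]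
      norm_num

/-- Dominated convergence, with the squared diameter of the compact space `M` as dominating
constant. -/
theorem tendsto_wasserstein2_pushforward {ι : Type*} {l : Filter ι} [l.IsCountablyGenerated]
    {f : ι → M → M} {g : M → M} (hf : ∀ᶠ i in l, AEMeasurable (f i) (μ : Measure M))
    (hg : AEMeasurable g (μ : Measure M)) (h : ∀ u, Tendsto (fun i => f i u) l (𝓝 (g u))) :
    Tendsto (fun i => wasserstein2 (pushforward (f i) μ) (pushforward g μ)) l (𝓝 0) := by
  have key : Tendsto (fun i => ∫⁻ u, edist (f i u) (g u) ^ 2 ∂(μ : Measure M)) l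
      (𝓝 (∫⁻ _, 0 ∂(μ : Measure M))) := by
    refine tendsto_lintegral_filter_of_dominated_convergence'
      (fun _ => Metric.ediam (univ : Set M) ^ 2) ?_ ?_ ?_ ?_
    · filter_upwards [hf] with i hi
      exact (hi.edist hg).pow_const 2
    · exact Eventually.of_forall fun i => ae_of_all _ fun u =>
        pow_le_pow_left₀ (zero_le) (Metric.edist_le_ediam_of_mem (mem_univ _) (mem_univ _)) 2
    · rw [lintegral_const, measure_univ, mul_one]
      exact ENNReal.pow_ne_top (isCompact_univ.isBounded.ediam_ne_top)
    · refine ae_of_all _ fun u => ?_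
      have := (tendsto_iff_edist_tendsto_0.1 (h u))
      simpa [Function.comp_def] using ((ENNReal.continuous_pow 2).tendsto 0).comp this
  have h2 := ((ENNReal.continuous_rpow_const (y := (1 / 2 : ℝ))).tendsto _).comp key
  simp only [lintegral_zero, Function.comp_def] at h2
  rw [ENNReal.zero_rpow_of_pos (by norm_num)] at h2
  refine tendsto_of_tendsto_of_tendsto_of_le_of_le' tendsto_const_nhds h2
    (Eventually.of_forall fun _ => zero_le) ?_
  filter_upwards [hf] with i hi
  exact wasserstein2_pushforward_le hi hg

theorem abs_sub_le_of_lipschitz_wasserstein2 {F : ProbabilityMeasure M → ℝ} {C : ℝ≥0}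
    (hF : ∀ μ ν, edist (F μ) (F ν) ≤ C * wasserstein2 μ ν) {f g : M → M}
    (hf : AEMeasurable f (μ : Measure M)) (hg : AEMeasurable g (μ : Measure M)) {δ : ℝ}
    (hδ : 0 ≤ δ) (h : ∀ u, dist (f u) (g u) ≤ δ) :
    |F (pushforward f μ) - F (pushforward g μ)| ≤ C * δ := by
  have h1 : wasserstein2 (pushforward f μ) (pushforward g μ) ≤ ENNReal.ofReal δ :=
    wasserstein2_pushforward_le_of_edist_le hf hg fun u => by
      rw [edist_dist]; exact ENNReal.ofReal_le_ofReal (h u)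
  have h2 : edist (F (pushforward f μ)) (F (pushforward g μ)) ≤ C * ENNReal.ofReal δ :=
    (hF _ _).trans (by gcongr)
  rw [edist_dist, ← ENNReal.ofReal_coe_nnreal, ← ENNReal.ofReal_mul C.coe_nonneg,
    ENNReal.ofReal_le_ofReal_iff (by positivity)] at h2
  exact h2

theorem tendsto_of_lipschitz_wasserstein2 {F : ProbabilityMeasure M → ℝ} {C : ℝ≥0}
    (hF : ∀ μ ν, edist (F μ) (F ν) ≤ C * wasserstein2 μ ν)
    {ι : Type*} {l : Filter ι} [l.IsCountablyGenerated]
    {f : ι → M → M} {g : M → M} (hf : ∀ᶠ i in l, AEMeasurable (f i) (μ : Measure M))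
    (hg : AEMeasurable g (μ : Measure M)) (h : ∀ u, Tendsto (fun i => f i u) l (𝓝 (g u))) :
    Tendsto (fun i => F (pushforward (f i) μ)) l (𝓝 (F (pushforward g μ))) := by
  rw [tendsto_iff_edist_tendsto_0]
  have h1 := ENNReal.Tendsto.const_mul (a := (C : ENNReal))
    (tendsto_wasserstein2_pushforward hf hg h) (Or.inr ENNReal.coe_ne_top)
  rw [mul_zero] at h1
  exact tendsto_of_tendsto_of_tendsto_of_le_of_le tendsto_const_nhds h1
    (fun _ => zero_le) fun _ => hF _ _

variable {d : ℕ} [ChartedSpace (EuclideanSpace ℝ (Fin d)) M] [IsManifold (𝓡 d) ∞ M]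
  [RiemannianBundle (fun x : M => TangentSpace (𝓡 d) x)]
  [IsContMDiffRiemannianBundle (𝓡 d) ∞ (EuclideanSpace ℝ (Fin d))
    (fun x : M => TangentSpace (𝓡 d) x)]

/-- Dominated convergence for the pairing of a Wasserstein gradient with a family of velocities. -/
theorem tendsto_integral_inner_gradient {D : ProbabilityMeasure M → ∀ x : M, TangentSpace (𝓡 d) x}
    (hD : ∀ ν, Continuous (fun x : M => (⟨x, D ν x⟩ : TangentBundle (𝓡 d) M))) {C : ℝ≥0}
    (hDC : ∀ μ ν x, ‖D μ x - D ν x‖ₑ ≤ C * wasserstein2 μ ν)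
    {ι : Type*} {l : Filter ι} [l.IsCountablyGenerated]
    {A : ι → M → TangentBundle (𝓡 d) M} {A₀ : M → TangentBundle (𝓡 d) M}
    (hA : ∀ᶠ i in l, AEStronglyMeasurable (A i) (μ : Measure M))
    (hA₀ : AEMeasurable (fun u => (A₀ u).1) (μ : Measure M))
    (hlim : ∀ u, Tendsto (fun i => A i u) l (𝓝 (A₀ u)))
    {B : ℝ} (hB : ∀ᶠ i in l, ∀ u, ‖(A i u).2‖ ≤ B) :
    Tendsto (fun i => ∫ u, inner ℝ (D (pushforward (fun u => (A i u).1) μ) (A i u).1) (A i u).2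
      ∂(μ : Measure M)) l
      (𝓝 (∫ u, inner ℝ (D (pushforward (fun u => (A₀ u).1) μ) (A₀ u).1) (A₀ u).2
        ∂(μ : Measure M))) := by
  set ν := pushforward (fun u => (A₀ u).1) μ
  have hproj : Continuous fun p : TangentBundle (𝓡 d) M => p.1 := FiberBundle.continuous_proj _ _
  have hW : Tendsto (fun i => wasserstein2 (pushforward (fun u => (A i u).1) μ) ν) l (𝓝 0) := by
    refine tendsto_wasserstein2_pushforward ?_ hA₀ fun u => (hproj.tendsto _).comp (hlim u)
    filter_upwards [hA] with i hi
    exact (Continuous.comp_aestronglyMeasurable hproj hi).aemeasurable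
  have hW' : Tendsto (fun i => (wasserstein2 (pushforward (fun u => (A i u).1) μ) ν).toReal) l
      (𝓝 0) := by
    simpa [Function.comp_def] using (ENNReal.tendsto_toReal ENNReal.zero_ne_top).comp hW
  have hdiff : ∀ᶠ i in l, ∀ x, ‖D (pushforward (fun u => (A i u).1) μ) x - D ν x‖ ≤
      C * (wasserstein2 (pushforward (fun u => (A i u).1) μ) ν).toReal := by
    filter_upwards [hW.eventually_lt_const ENNReal.zero_lt_top] with i hi x
    have := ENNReal.toReal_mono (ENNReal.mul_ne_top ENNReal.coe_ne_top hi.ne) (hDC _ ν x)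
    simpa using this
  obtain ⟨K, hK0, hK⟩ := exists_norm_section_le (hD ν)
  -- Once the Wasserstein distance to `ν` is at most one, the gradients are bounded by `C * 1 + K`.
  refine tendsto_integral_filter_of_dominated_convergence (fun _ => (C * 1 + K) * B) ?_ ?_
    (integrable_const _) ?_
  · filter_upwards [hA] with i hi
    exact Continuous.comp_aestronglyMeasurable (continuous_inner_section (hD _)) hi
  · filter_upwards [hdiff, hB, hW'.eventually_le_const one_pos] with i h1 h2 h3
    refine ae_of_all _ fun u => (norm_inner_le_norm _ _).trans ?_
    gcongr
    · calc ‖D (pushforward (fun u => (A i u).1) μ) (A i u).1‖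
          = ‖(D (pushforward (fun u => (A i u).1) μ) (A i u).1 - D ν (A i u).1)
            + D ν (A i u).1‖ := by rw [sub_add_cancel]
        _ ≤ C * 1 + K := by
          refine (norm_add_le _ _).trans (add_le_add ((h1 _).trans ?_) (hK _))
          gcongr
    · exact h2 u
  · refine ae_of_all _ fun u => ?_
    have h1 := ((continuous_inner_section (hD ν)).tendsto (A₀ u)).comp (hlim u)
    -- The change of the measure in `D` contributes a term that vanishes uniformly in space; `h1`
    -- treats the moving tangent vector with the measure frozen at `ν`.
    have h2 : Tendsto (fun i => inner ℝ (D (pushforward (fun u => (A i u).1) μ) (A i u).1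
        - D ν (A i u).1) (A i u).2) l (𝓝 0) := by
      have h3 := (hW'.const_mul (C : ℝ)).mul_const B
      rw [mul_zero, zero_mul] at h3
      refine squeeze_zero_norm' ?_ h3
      filter_upwards [hdiff, hB] with i h1 h2
      refine (norm_inner_le_norm _ _).trans ?_
      gcongr
      · exact h1 _
      · exact h2 u
    have h4 := h2.add h1
    rw [zero_add] at h4
    refine h4.congr fun i => ?_
    simp only [Function.comp, inner_sub_left, sub_add_cancel]

end Wasserstein

/-! ### Separating curves through given tangent vectors. -/

section LocalCurves

variable {E : Type*} [NormedAddCommGroup E] [NormedSpace ℝ E]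
  {H : Type*} [TopologicalSpace H] {I : ModelWithCorners ℝ E H}
  {M : Type*} [TopologicalSpace M] [ChartedSpace H M]

theorem hasMFDerivAt_comp_sub_const {c : ℝ → M} {v : ∀ t, TangentSpace I (c t)} {t t₀ : ℝ}
    (h : HasMFDerivAt 𝓘(ℝ, ℝ) I c (t - t₀) ((1 : ℝ →L[ℝ] ℝ).smulRight (v (t - t₀)))) :
    HasMFDerivAt 𝓘(ℝ, ℝ) I (fun s => c (s - t₀)) t
      ((1 : ℝ →L[ℝ] ℝ).smulRight (v (t - t₀))) := by
  obtain ⟨hc, hd⟩ := hasMFDerivWithinAt_curve_iff.1 (hasMFDerivWithinAt_univ.2 h)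
  refine hasMFDerivWithinAt_univ.1 (hasMFDerivWithinAt_curve_iff.2 ⟨?_, ?_⟩)
  · rw [continuousWithinAt_univ] at hc ⊢
    exact ContinuousAt.comp (f := fun s => s - t₀) hc (by fun_prop)
  · rw [hasDerivWithinAt_univ] at hd ⊢
    exact hd.comp_sub_const t t₀

/-- Through every tangent vector passes a continuously differentiable curve at time `t₀`, and the
curves of different tangent vectors do not meet shortly before and after `t₀`. -/
theorem exists_curves [IsManifold I 1 M] [I.Boundaryless] [T2Space M] (t₀ : ℝ) :
    ∃ (L : TangentBundle I M → ℝ → M) (W : ∀ p t, TangentSpace I (L p t)),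
      (∀ p, ∀ᶠ t in 𝓝 t₀,
        HasMFDerivAt 𝓘(ℝ, ℝ) I (L p) t ((1 : ℝ →L[ℝ] ℝ).smulRight (W p t))) ∧
      (∀ p, (⟨L p t₀, W p t₀⟩ : TangentBundle I M) = p) ∧
      (∀ p, Tendsto (fun t => (⟨L p t, W p t⟩ : TangentBundle I M)) (𝓝 t₀) (𝓝 p)) ∧
      ∀ p q, p ≠ q → ∀ᶠ t in 𝓝[≠] t₀, L p t ≠ L q t := by
  choose V hV hV0 hVlim using exists_velocity_chartLine (I := I) (M := M)
  have hsub : Tendsto (fun t : ℝ => t - t₀) (𝓝 t₀) (𝓝 0) := by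
    have : Continuous fun t : ℝ => t - t₀ := by fun_prop
    simpa using this.tendsto t₀
  refine ⟨fun p t => chartLine p (t - t₀), fun p t => V p (t - t₀), fun p => ?_, fun p => ?_,
    fun p => (hVlim p).comp hsub, fun p q hpq => ?_⟩
  · filter_upwards [hsub.eventually (hV p)] with t ht
    exact hasMFDerivAt_comp_sub_const ht
  · change (⟨chartLine p (t₀ - t₀), V p (t₀ - t₀)⟩ : TangentBundle I M) = p
    rw [sub_self]
    exact hV0 p
  · have hsub' : Tendsto (fun t : ℝ => t - t₀) (𝓝[≠] t₀) (𝓝[≠] 0) := by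
      refine tendsto_nhdsWithin_iff.2 ⟨hsub.mono_left nhdsWithin_le_nhds, ?_⟩
      filter_upwards [self_mem_nhdsWithin] with t ht
      simpa [sub_eq_zero] using ht
    exact hsub'.eventually (eventually_chartLine_ne hpq)

end LocalCurves

theorem SimpleFunc.aemeasurable_curve {M ι : Type*} [MeasurableSpace M] {μ : ProbabilityMeasure M}
    (T : SimpleFunc M ι) (c : ι → ℝ → M) (t : ℝ) :
    AEMeasurable (fun u => c (T u) t) (μ : Measure M) :=
  (T.map fun i => c i t).measurable.aemeasurable

/-! ### The chain rule for finitely many curves. -/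

section SimpleFamilies

variable {M : Type*} [MetricSpace M] [CompactSpace M] [MeasurableSpace M] [BorelSpace M]
  {μ : ProbabilityMeasure M} {F : ProbabilityMeasure M → ℝ} {C : ℝ≥0} {ι : Type*}

/-- Only finitely many curves occur, so their first-order closeness is uniform in `u` and passes to
`F` by the Lipschitz bound. -/
theorem hasDerivWithinAt_pushforward_congr
    (hF : ∀ μ ν, edist (F μ) (F ν) ≤ C * wasserstein2 μ ν) (T : SimpleFunc M ι)
    {c₁ c₂ : ι → ℝ → M} {S : Set ℝ} {t₀ a : ℝ}
    (h₀ : ∀ u, c₁ (T u) t₀ = c₂ (T u) t₀)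
    (h : ∀ u, (fun t => dist (c₁ (T u) t) (c₂ (T u) t)) =o[𝓝[S] t₀] fun t => t - t₀)
    (hd : HasDerivWithinAt (fun t => F (pushforward (fun u => c₂ (T u) t) μ)) a S t₀) :
    HasDerivWithinAt (fun t => F (pushforward (fun u => c₁ (T u) t) μ)) a S t₀ := by
  have key : (fun t => F (pushforward (fun u => c₁ (T u) t) μ)
      - F (pushforward (fun u => c₂ (T u) t) μ)) =o[𝓝[S] t₀] fun t => t - t₀ := by
    -- Of the two factors `(C + 1)⁻¹` in `hall`, one absorbs the Lipschitz constant and the other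
    -- matches this comparison function; `C + 1` avoids dividing by zero.
    refine IsLittleO.trans_isBigO (g := fun t => ((C : ℝ) + 1)⁻¹ * (t - t₀)) ?_
      (isBigO_const_mul_self _ _ _)
    refine isLittleO_iff.2 fun ε hε => ?_
    have hall : ∀ᶠ t in 𝓝[S] t₀, ∀ i ∈ T.range,
        dist (c₁ i t) (c₂ i t) ≤ ε * ((C : ℝ) + 1)⁻¹ * ((C : ℝ) + 1)⁻¹ * ‖t - t₀‖ := by
      refine (Filter.eventually_all_finset T.range).2 fun i hi => ?_
      obtain ⟨u, rfl⟩ := SimpleFunc.mem_range.1 hi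
      have hpos : 0 < ε * ((C : ℝ) + 1)⁻¹ * ((C : ℝ) + 1)⁻¹ := by positivity
      filter_upwards [isLittleO_iff.1 (h u) hpos] with t ht
      rwa [Real.norm_of_nonneg dist_nonneg] at ht
    filter_upwards [hall] with t ht
    have h1 := abs_sub_le_of_lipschitz_wasserstein2 (μ := μ) hF (SimpleFunc.aemeasurable_curve T c₁ t)
      (SimpleFunc.aemeasurable_curve T c₂ t) (by positivity) fun u => ht _ (T.mem_range_self u)
    rw [Real.norm_eq_abs, norm_mul, norm_inv, Real.norm_of_nonneg (by positivity : 0 ≤ (C : ℝ) + 1)]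
    refine h1.trans ?_
    have h2 : (C : ℝ) * ((C : ℝ) + 1)⁻¹ ≤ 1 := by
      rw [← div_eq_mul_inv, div_le_one (by positivity)]
      linarith
    calc (C : ℝ) * (ε * ((C : ℝ) + 1)⁻¹ * ((C : ℝ) + 1)⁻¹ * ‖t - t₀‖)
        = (C * ((C : ℝ) + 1)⁻¹) * (ε * (((C : ℝ) + 1)⁻¹ * ‖t - t₀‖)) := by ring
      _ ≤ 1 * (ε * (((C : ℝ) + 1)⁻¹ * ‖t - t₀‖)) := by gcongr
      _ = _ := one_mul _
  rw [hasDerivWithinAt_iff_isLittleO] at hd ⊢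
  have heq : pushforward (fun u => c₁ (T u) t₀) μ = pushforward (fun u => c₂ (T u) t₀) μ := by
    simp only [h₀]
  refine (key.add hd).congr_left fun t => ?_
  rw [heq]
  ring

variable {d : ℕ} [ChartedSpace (EuclideanSpace ℝ (Fin d)) M] [IsManifold (𝓡 d) ∞ M]
  [RiemannianBundle (fun x : M => TangentSpace (𝓡 d) x)]
  [IsContMDiffRiemannianBundle (𝓡 d) ∞ (EuclideanSpace ℝ (Fin d))
    (fun x : M => TangentSpace (𝓡 d) x)]
  [IsRiemannianManifold (𝓡 d) M]

/-- The chain rule for a finite family of curves at a time when the velocities of the curves are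
determined by their positions. -/
theorem hasDerivWithinAt_pushforward_of_injective
    (hF : ∀ μ ν, edist (F μ) (F ν) ≤ C * wasserstein2 μ ν)
    {D : ProbabilityMeasure M → ∀ x : M, TangentSpace (𝓡 d) x}
    (hD : ∀ ν, IsIntrinsicGradient F ν (D ν)) (T : SimpleFunc M ι)
    {c : ι → ℝ → M} {t₀ : ℝ} {v : ∀ i, TangentSpace (𝓡 d) (c i t₀)} {S : Set ℝ}
    (hc : ∀ u, HasMFDerivWithinAt 𝓘(ℝ, ℝ) (𝓡 d) (c (T u)) S t₀
      ((1 : ℝ →L[ℝ] ℝ).smulRight (v (T u))))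
    (hinj : ∀ u w, c (T u) t₀ = c (T w) t₀ →
      (⟨c (T u) t₀, v (T u)⟩ : TangentBundle (𝓡 d) M) = ⟨c (T w) t₀, v (T w)⟩) :
    HasDerivWithinAt (fun t => F (pushforward (fun u => c (T u) t) μ))
      (∫ u, inner ℝ (D (pushforward (fun u => c (T u) t₀) μ) (c (T u) t₀)) (v (T u))
        ∂(μ : Measure M)) S t₀ := by
  have := isContinuousRiemannianBundle_tangentSpace d M
  let P : Set (TangentBundle (𝓡 d) M) :=
    range fun u => (⟨c (T u) t₀, v (T u)⟩ : TangentBundle (𝓡 d) M)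
  have hP : P.Finite :=
    (T.map fun i => (⟨c i t₀, v i⟩ : TangentBundle (𝓡 d) M)).finite_range
  obtain ⟨V, hV⟩ := exists_smoothVectorField_eq hP (by
    rintro _ ⟨u, rfl⟩ _ ⟨w, rfl⟩ h
    exact hinj u w h)
  have hV' : ∀ u, V (c (T u) t₀) = v (T u) := fun u => hV _ ⟨u, rfl⟩
  set ν := pushforward (fun u => c (T u) t₀) μ with hν
  have hm : AEMeasurable (fun u => c (T u) t₀) (μ : Measure M) :=
    SimpleFunc.aemeasurable_curve T c t₀
  obtain ⟨Φ, hΦ, hder⟩ := (hD ν).hasIntrinsicDerivAt V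
  have hint : ∫ x, inner ℝ (D ν x) (V x) ∂(ν : Measure M) =
      ∫ u, inner ℝ (D ν (c (T u) t₀)) (v (T u)) ∂(μ : Measure M) := by
    have hVc : Continuous fun x => (⟨x, V x⟩ : TangentBundle (𝓡 d) M) := V.contMDiff.continuous
    have hi := ((hD ν).integrable_inner hVc).aestronglyMeasurable
    rw [hν, coe_pushforward hm, ← hν] at hi ⊢
    rw [integral_map hm hi]
    simp only [hV']
  have hpush : ∀ ε, pushforward (Φ ε) ν = pushforward (fun u => Φ ε (c (T u) t₀)) μ := fun ε =>
    pushforward_pushforward (Φ.continuous continuous_const continuous_id).measurable hm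
  simp only [hpush, hint] at hder
  -- The comparison curves follow the flow of `V`, shifted to pass through the positions at time
  -- `t₀`.
  refine hasDerivWithinAt_pushforward_congr hF T (c₂ := fun i t => Φ (t - t₀) (c i t₀))
    (fun u => by simp) (fun u => ?_) ?_
  · have h1 := (hΦ (c (T u) t₀)).comp_add (-t₀)
    refine isLittleO_dist_of_hasMFDerivWithinAt (hc u) (h1 t₀).hasMFDerivWithinAt ?_
    have : ∀ x, x = c (T u) t₀ → (⟨c (T u) t₀, v (T u)⟩ : TangentBundle (𝓡 d) M) = ⟨x, V x⟩ := by
      rintro _ rfl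
      rw [hV']
    exact this _ (by simp)
  · have h2 : HasDerivAt (fun ε => F (pushforward (fun u => Φ ε (c (T u) t₀)) μ))
        (∫ u, inner ℝ (D ν (c (T u) t₀)) (v (T u)) ∂(μ : Measure M)) (t₀ - t₀) := by
      rwa [sub_self]
    exact (h2.comp_sub_const t₀ t₀).hasDerivWithinAt

/-- The chain rule for a finite family of curves. -/
theorem hasDerivWithinAt_Ici_pushforward_simpleFunc
    (hF : ∀ μ ν, edist (F μ) (F ν) ≤ C * wasserstein2 μ ν)
    {D : ProbabilityMeasure M → ∀ x : M, TangentSpace (𝓡 d) x}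
    (hD : ∀ ν, IsIntrinsicGradient F ν (D ν))
    (hDc : ∀ ν, Continuous (fun x : M => (⟨x, D ν x⟩ : TangentBundle (𝓡 d) M))) {K : ℝ≥0}
    (hDK : ∀ μ ν x, ‖D μ x - D ν x‖ₑ ≤ K * wasserstein2 μ ν) (T : SimpleFunc M ι)
    {c : ι → ℝ → M} {t₀ : ℝ} {v : ∀ i, TangentSpace (𝓡 d) (c i t₀)}
    (hc : ∀ u, HasMFDerivWithinAt 𝓘(ℝ, ℝ) (𝓡 d) (c (T u)) (Ici t₀) t₀
      ((1 : ℝ →L[ℝ] ℝ).smulRight (v (T u)))) :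
    HasDerivWithinAt (fun t => F (pushforward (fun u => c (T u) t) μ))
      (∫ u, inner ℝ (D (pushforward (fun u => c (T u) t₀) μ) (c (T u) t₀)) (v (T u))
        ∂(μ : Measure M)) (Ici t₀) t₀ := by
  have := isContinuousRiemannianBundle_tangentSpace d M
  obtain ⟨L, W, hL, hL0, hLlim, hLne⟩ := exists_curves (I := 𝓡 d) (M := M) t₀
  let p : ι → TangentBundle (𝓡 d) M := fun i => ⟨c i t₀, v i⟩
  -- Indexing by tangent vectors merges curves with the same position and velocity, so distinct
  -- indices give lines that separate.
  let T' : SimpleFunc M (TangentBundle (𝓡 d) M) := T.map p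
  have hproj : Continuous fun p : TangentBundle (𝓡 d) M => p.1 := FiberBundle.continuous_proj _ _
  have hLp : ∀ q, L q t₀ = q.1 := fun q => congrArg TotalSpace.proj (hL0 q)
  refine hasDerivWithinAt_pushforward_congr hF T (c₂ := fun i t => L (p i) t)
    (fun u => (hLp (p (T u))).symm) (fun u => ?_) ?_
  · exact isLittleO_dist_of_hasMFDerivWithinAt (hc u)
      (hL (p (T u))).self_of_nhds.hasMFDerivWithinAt (hL0 (p (T u))).symm
  let A : ℝ → M → TangentBundle (𝓡 d) M := fun t u => ⟨L (T' u) t, W (T' u) t⟩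
  have hgood : ∀ᶠ t in 𝓝[>] t₀, HasDerivAt (fun t => F (pushforward (fun u => L (T' u) t) μ))
      (∫ u, inner ℝ (D (pushforward (fun u => (A t u).1) μ) (A t u).1) (A t u).2
        ∂(μ : Measure M)) t := by
    have h1 : ∀ᶠ t in 𝓝[>] t₀, ∀ q ∈ T'.range,
        HasMFDerivAt 𝓘(ℝ, ℝ) (𝓡 d) (L q) t ((1 : ℝ →L[ℝ] ℝ).smulRight (W q t)) :=
      (Filter.eventually_all_finset _).2 fun q _ => nhdsWithin_le_nhds (hL q)
    have h2 : ∀ᶠ t in 𝓝[>] t₀, ∀ q ∈ T'.range, ∀ r ∈ T'.range, q ≠ r → L q t ≠ L r t := by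
      refine (Filter.eventually_all_finset _).2 fun q _ =>
        (Filter.eventually_all_finset _).2 fun r _ => ?_
      by_cases h : q = r
      · exact Eventually.of_forall fun t hne => (hne h).elim
      · filter_upwards [nhdsWithin_mono _ (fun t (ht : t₀ < t) => ht.ne') (hLne q r h)] with t ht _
        exact ht
    filter_upwards [h1, h2] with t ht1 ht2
    rw [← hasDerivWithinAt_univ]
    refine hasDerivWithinAt_pushforward_of_injective hF hD T' (c := L) (v := fun q => W q t)
      (fun u => (ht1 _ (T'.mem_range_self u)).hasMFDerivWithinAt) fun u w h => ?_
    have : T' u = T' w := by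
      by_contra hne
      exact ht2 _ (T'.mem_range_self u) _ (T'.mem_range_self w) hne h
    rw [this]
  have hlimA : ∀ u, Tendsto (fun t => A t u) (𝓝 t₀) (𝓝 (T' u)) := fun u => hLlim _
  refine hasDerivWithinAt_Ici_of_tendsto_deriv
    (s := {t | HasDerivAt (fun t => F (pushforward (fun u => L (T' u) t) μ))
      (∫ u, inner ℝ (D (pushforward (fun u => (A t u).1) μ) (A t u).1) (A t u).2
        ∂(μ : Measure M)) t})
    (fun t ht => ht.differentiableAt.differentiableWithinAt) ?_ hgood ?_
  · refine (tendsto_of_lipschitz_wasserstein2 (μ := μ) hF (f := fun t u => L (T' u) t)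
      (Eventually.of_forall fun t => SimpleFunc.aemeasurable_curve T' L t)
      (SimpleFunc.aemeasurable_curve T' L t₀) fun u => ?_).mono_left nhdsWithin_le_nhds
    rw [hLp]
    exact (hproj.tendsto _).comp (hlimA u)
  · obtain ⟨B, hB⟩ := (T'.range.image fun q => ‖q.2‖).bddAbove
    have hBd : ∀ᶠ t in 𝓝[>] t₀, ∀ u, ‖(A t u).2‖ ≤ B + 1 := by
      have : ∀ᶠ t in 𝓝[>] t₀, ∀ q ∈ T'.range, ‖W q t‖ ≤ B + 1 := by
        refine (Filter.eventually_all_finset _).2 fun q hq => ?_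
        have h1 := (continuous_norm_tangentBundle.tendsto q).comp (hLlim q)
        have h2 : ‖q.2‖ < B + 1 :=
          (hB (Finset.mem_coe.2 (Finset.mem_image_of_mem _ hq))).trans_lt (lt_add_one B)
        exact nhdsWithin_le_nhds (h1.eventually_le_const h2)
      filter_upwards [this] with t ht u
      exact ht _ (T'.mem_range_self u)
    have h := tendsto_integral_inner_gradient (μ := μ) hDc hDK (A := A) (A₀ := T') (l := 𝓝[>] t₀)
      (Eventually.of_forall fun t => (T'.map fun q =>
        (⟨L q t, W q t⟩ : TangentBundle (𝓡 d) M)).stronglyMeasurable.aestronglyMeasurable)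
      (T'.map TotalSpace.proj).measurable.aemeasurable
      (fun u => (hlimA u).mono_left nhdsWithin_le_nhds) hBd
    refine h.congr' ?_
    filter_upwards [hgood] with t ht
    exact ht.deriv.symm

end SimpleFamilies

/-! ### Passage from finitely many curves to the whole family. -/

section ChainRule

variable {d : ℕ} {M : Type*} [MetricSpace M] [CompactSpace M]
  [ChartedSpace (EuclideanSpace ℝ (Fin d)) M] [IsManifold (𝓡 d) ∞ M]
  [RiemannianBundle (fun x : M => TangentSpace (𝓡 d) x)]
  [IsContMDiffRiemannianBundle (𝓡 d) ∞ (EuclideanSpace ℝ (Fin d))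
    (fun x : M => TangentSpace (𝓡 d) x)]

/-- Tube lemma: compactness of `M` makes one neighbourhood of `θ` serve all `u`. -/
theorem eventually_norm_velocity_le {J : Set ℝ} {x : ℝ → M → M}
    {x' : ∀ (θ : ℝ) (u : M), TangentSpace (𝓡 d) (x θ u)}
    (hx' : ContinuousOn
      (fun p : ℝ × M => (⟨x p.1 p.2, x' p.1 p.2⟩ : TangentBundle (𝓡 d) M)) (J ×ˢ univ))
    {θ : ℝ} (hθ : θ ∈ J) :
    ∃ B, ∀ᶠ r in 𝓝[J] θ, ∀ u, ‖x' r u‖ ≤ B := by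
  have hcont : ContinuousOn (fun p : ℝ × M => ‖x' p.1 p.2‖) (J ×ˢ univ) := by
    have h := Continuous.comp_continuousOn (continuous_norm_tangentBundle (d := d) (M := M)) hx'
    exact h
  have hθc : ContinuousOn (fun u => ‖x' θ u‖) univ :=
    hcont.comp (f := fun u : M => (θ, u)) (by fun_prop) fun u _ => ⟨hθ, mem_univ _⟩
  obtain ⟨B, hB⟩ := isCompact_univ.exists_bound_of_continuousOn hθc
  refine ⟨B + 1, ?_⟩
  have h : {p : ℝ × M | ‖x' p.1 p.2‖ ≤ B + 1} ∈ 𝓝[J] θ ×ˢ 𝓝ˢ (univ : Set M) := by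
    refine isCompact_univ.mem_prod_nhdsSet_of_forall fun u _ => ?_
    have h1 := hcont (θ, u) ⟨hθ, mem_univ _⟩
    rw [ContinuousWithinAt, nhdsWithin_prod_eq, nhdsWithin_univ] at h1
    have h2 : ‖x' θ u‖ < B + 1 := by
      have := hB u (mem_univ u)
      rw [norm_norm] at this
      linarith
    exact h1.eventually_le_const h2
  rw [nhdsSet_univ, ← principal_univ] at h
  obtain ⟨s, hs, t, ht, hst⟩ := mem_prod_iff.1 h
  filter_upwards [hs] with r hr u
  exact hst (mk_mem_prod hr (mem_principal.1 ht (mem_univ u)))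

theorem tendsto_nhdsWithin_prod_univ {X Y : Type*} [TopologicalSpace X] [TopologicalSpace Y]
    {ι : Type*} {l : Filter ι} {J : Set X} {f : ι → X} {g : ι → Y} {a : X} {b : Y}
    (hf : Tendsto f l (𝓝[J] a)) (hg : Tendsto g l (𝓝 b)) :
    Tendsto (fun i => (f i, g i)) l (𝓝[J ×ˢ univ] (a, b)) := by
  rw [nhdsWithin_prod_eq, nhdsWithin_univ]
  exact hf.prodMk hg

variable [MeasurableSpace M] [BorelSpace M] [IsRiemannianManifold (𝓡 d) M]

/-- The mean value inequality along a finite family of curves. -/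
theorem abs_pushforward_simpleFunc_sub_le {F : ProbabilityMeasure M → ℝ} {μ : ProbabilityMeasure M}
    {C : ℝ≥0} (hF : ∀ μ ν, edist (F μ) (F ν) ≤ C * wasserstein2 μ ν)
    {D : ProbabilityMeasure M → ∀ x : M, TangentSpace (𝓡 d) x}
    (hD : ∀ ν, IsIntrinsicGradient F ν (D ν))
    (hDc : ∀ ν, Continuous (fun x : M => (⟨x, D ν x⟩ : TangentBundle (𝓡 d) M))) {K : ℝ≥0}
    (hDK : ∀ μ ν x, ‖D μ x - D ν x‖ₑ ≤ K * wasserstein2 μ ν) (T : SimpleFunc M M)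
    {J : Set ℝ} {x : ℝ → M → M} {x' : ∀ (θ : ℝ) (u : M), TangentSpace (𝓡 d) (x θ u)}
    (hx : ∀ θ ∈ J, ∀ u : M, HasMFDerivWithinAt 𝓘(ℝ, ℝ) (𝓡 d) (fun s => x s u) J θ
      ((1 : ℝ →L[ℝ] ℝ).smulRight (x' θ u)))
    {a b : ℝ} (hab : a ≤ b) (hJ : Icc a b ⊆ J) {m ε : ℝ}
    (hm : ∀ r ∈ Icc a b, |∫ u, inner ℝ (D (pushforward (fun u => x r (T u)) μ) (x r (T u)))
      (x' r (T u)) ∂(μ : Measure M) - m| ≤ ε) :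
    |F (pushforward (fun u => x b (T u)) μ) - F (pushforward (fun u => x a (T u)) μ)
      - (b - a) * m| ≤ ε * (b - a) := by
  -- Subtracting the linear function of slope `m` leaves a right derivative bounded by `ε`.
  let f : ℝ → ℝ := fun r => F (pushforward (fun u => x r (T u)) μ) - r * m
  have hcont : ContinuousOn f (Icc a b) := by
    refine ContinuousOn.sub (fun r hr => ?_) (by fun_prop)
    refine tendsto_of_lipschitz_wasserstein2 (μ := μ) hF (f := fun r u => x r (T u))
      (Eventually.of_forall fun t => SimpleFunc.aemeasurable_curve T (fun y t => x t y) t)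
      (SimpleFunc.aemeasurable_curve T (fun y t => x t y) r) fun u => ?_
    exact ((hx r (hJ hr) (T u)).continuousWithinAt.mono hJ).tendsto
  have hder : ∀ r ∈ Ico a b, HasDerivWithinAt f
      (∫ u, inner ℝ (D (pushforward (fun u => x r (T u)) μ) (x r (T u))) (x' r (T u))
        ∂(μ : Measure M) - m) (Ici r) r := by
    intro r hr
    have hmem : J ∈ 𝓝[Ici r] r :=
      mem_of_superset (Icc_mem_nhdsGE hr.2) ((Icc_subset_Icc_left hr.1).trans hJ)
    have h1 := hasDerivWithinAt_Ici_pushforward_simpleFunc (μ := μ) hF hD hDc hDK T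
      (c := fun y t => x t y) (t₀ := r) (v := fun y => x' r y)
      fun u => (hx r (hJ (Ico_subset_Icc_self hr)) (T u)).mono_of_mem_nhdsWithin hmem
    have h2 := h1.sub ((hasDerivWithinAt_id r (Ici r)).mul_const m)
    rw [one_mul] at h2
    exact h2
  have h := norm_image_sub_le_of_norm_deriv_right_le_segment hcont hder
    (fun r hr => hm r (Ico_subset_Icc_self hr)) b (right_mem_Icc.2 hab)
  rw [Real.norm_eq_abs] at h
  convert h using 2
  simp only [f]
  ring

theorem hasDerivWithinAt_pushforward {F : ProbabilityMeasure M → ℝ} {μ : ProbabilityMeasure M}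
    {C : ℝ≥0} (hF : ∀ μ ν, edist (F μ) (F ν) ≤ C * wasserstein2 μ ν)
    {D : ProbabilityMeasure M → ∀ x : M, TangentSpace (𝓡 d) x}
    (hD : ∀ ν, IsIntrinsicGradient F ν (D ν))
    (hDc : ∀ ν, Continuous (fun x : M => (⟨x, D ν x⟩ : TangentBundle (𝓡 d) M))) {K : ℝ≥0}
    (hDK : ∀ μ ν x, ‖D μ x - D ν x‖ₑ ≤ K * wasserstein2 μ ν)
    {J : Set ℝ} (hJ : J.OrdConnected)
    {x : ℝ → M → M} {x' : ∀ (θ : ℝ) (u : M), TangentSpace (𝓡 d) (x θ u)}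
    (hx : ∀ θ ∈ J, ∀ u : M, HasMFDerivWithinAt 𝓘(ℝ, ℝ) (𝓡 d) (fun s => x s u) J θ
      ((1 : ℝ →L[ℝ] ℝ).smulRight (x' θ u)))
    (hx_cont : ContinuousOn (fun p : ℝ × M => x p.1 p.2) (J ×ˢ univ))
    (hx'_cont : ContinuousOn
      (fun p : ℝ × M => (⟨x p.1 p.2, x' p.1 p.2⟩ : TangentBundle (𝓡 d) M)) (J ×ˢ univ))
    {θ : ℝ} (hθ : θ ∈ J) :
    HasDerivWithinAt (fun s => F (pushforward (x s) μ))
      (∫ u, inner ℝ (D (pushforward (x θ) μ) (x θ u)) (x' θ u) ∂(μ : Measure M)) J θ := by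
  obtain ⟨x₀⟩ : Nonempty M := nonempty_of_isProbabilityMeasure (μ : Measure M)
  let T : ℕ → SimpleFunc M M := SimpleFunc.approxOn id measurable_id univ x₀ (mem_univ x₀)
  have hT : ∀ u, Tendsto (fun n => T n u) atTop (𝓝 u) := fun u =>
    SimpleFunc.tendsto_approxOn measurable_id (mem_univ x₀) (by simp)
  have hxm : ∀ s ∈ J, AEMeasurable (x s) (μ : Measure M) := by
    intro s hs
    have : ContinuousOn (x s) univ :=
      hx_cont.comp (f := fun u : M => (s, u)) (by fun_prop) fun u _ => ⟨hs, mem_univ _⟩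
    exact (continuousOn_univ.1 this).measurable.aemeasurable
  set m := ∫ u, inner ℝ (D (pushforward (x θ) μ) (x θ u)) (x' θ u) ∂(μ : Measure M)
  let A : ℕ × ℝ → M → TangentBundle (𝓡 d) M := fun q u => ⟨x q.2 (T q.1 u), x' q.2 (T q.1 u)⟩
  obtain ⟨B, hB⟩ := eventually_norm_velocity_le hx'_cont hθ
  -- The limit is joint in the index and the time, so the radius `δ` below does not depend on `n`.
  have hlim := tendsto_integral_inner_gradient (μ := μ) hDc hDK (A := A)
    (A₀ := fun u => ⟨x θ u, x' θ u⟩) (l := atTop ×ˢ 𝓝[J] θ) (B := B)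
    (Eventually.of_forall fun q => ((T q.1).map fun y =>
      (⟨x q.2 y, x' q.2 y⟩ : TangentBundle (𝓡 d) M)).stronglyMeasurable.aestronglyMeasurable)
    (hxm θ hθ)
    (fun u => (hx'_cont (θ, u) ⟨hθ, mem_univ _⟩).tendsto.comp
      (tendsto_nhdsWithin_prod_univ tendsto_snd ((hT u).comp tendsto_fst)))
    (by filter_upwards [tendsto_snd.eventually hB] with q hq u using hq _)
  have hFlim : ∀ s ∈ J, Tendsto (fun n => F (pushforward (fun u => x s (T n u)) μ)) atTop
      (𝓝 (F (pushforward (x s) μ))) := fun s hs =>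
    tendsto_of_lipschitz_wasserstein2 hF
      (Eventually.of_forall fun n => SimpleFunc.aemeasurable_curve (T n) (fun y t => x t y) s)
      (hxm s hs) fun u => (hx_cont (s, u) ⟨hs, mem_univ _⟩).tendsto.comp
        (tendsto_nhdsWithin_prod_univ (tendsto_nhdsWithin_iff.2
          ⟨tendsto_const_nhds, Eventually.of_forall fun _ => hs⟩) (hT u))
  refine hasDerivWithinAt_iff_isLittleO.2 (isLittleO_iff.2 fun ε hε => ?_)
  obtain ⟨pa, hpa, pb, hpb, hp⟩ := eventually_prod_iff.1
    (hlim.eventually (Metric.closedBall_mem_nhds _ hε))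
  obtain ⟨δ, hδ, hball⟩ := Metric.mem_nhdsWithin_iff.1 hpb
  filter_upwards [inter_mem_nhdsWithin J (Metric.ball_mem_nhds θ hδ)] with s hs
  have hord : (Metric.ball θ δ ∩ J).OrdConnected := by
    rw [Real.ball_eq_Ioo]
    exact ordConnected_Ioo.inter hJ
  have hmem : ∀ n, pa n → ∀ r ∈ Metric.ball θ δ ∩ J,
      |∫ u, inner ℝ (D (pushforward (fun u => x r (T n u)) μ) (x r (T n u)))
        (x' r (T n u)) ∂(μ : Measure M) - m| ≤ ε := fun n hn r hr => hp hn (hball hr)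
  have hθ' : θ ∈ Metric.ball θ δ ∩ J := ⟨Metric.mem_ball_self hδ, hθ⟩
  have hs' : s ∈ Metric.ball θ δ ∩ J := ⟨hs.2, hs.1⟩
  -- With `s` fixed, the estimate for each large `n` passes to the limit because `F` is continuous
  -- along both image measures.
  refine le_of_tendsto (((hFlim s hs.1).sub (hFlim θ hθ)).sub_const _).norm ?_
  filter_upwards [hpa] with n hn
  rw [Real.norm_eq_abs, Real.norm_eq_abs, smul_eq_mul]
  rcases le_total θ s with h | h
  · have hsub := hord.out hθ' hs'
    rw [abs_of_nonneg (sub_nonneg.2 h)]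
    exact abs_pushforward_simpleFunc_sub_le hF hD hDc hDK (T n) hx h (hsub.trans inter_subset_right)
      fun r hr => hmem n hn r (hsub hr)
  · have hsub := hord.out hs' hθ'
    rw [abs_of_nonpos (sub_nonpos.2 h), neg_sub]
    have := abs_pushforward_simpleFunc_sub_le hF hD hDc hDK (T n) hx h
      (hsub.trans inter_subset_right) fun r hr => hmem n hn r (hsub hr)
    refine (le_of_eq ?_).trans this
    rw [← abs_neg]
    congr 1
    ring

end ChainRule

end

theorem mainTheorem10 {d : ℕ} {M : Type*} [MetricSpace M] [CompactSpace M] [ConnectedSpace M]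
    [MeasurableSpace M] [BorelSpace M]
    [ChartedSpace (EuclideanSpace ℝ (Fin d)) M] [IsManifold (𝓡 d) ∞ M]
    [RiemannianBundle (fun x : M => TangentSpace (𝓡 d) x)]
    [IsContMDiffRiemannianBundle (𝓡 d) ∞ (EuclideanSpace ℝ (Fin d))
      (fun x : M => TangentSpace (𝓡 d) x)]
    [IsRiemannianManifold (𝓡 d) M]
    (F : ProbabilityMeasure M → ℝ) (hF : IsC11 d F)
    (μ : ProbabilityMeasure M)
    -- the interval `J` of parameters, the family of maps `x` and its velocity `x'`
    (J : Set ℝ) (hJ : J.OrdConnected)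
    (x : ℝ → M → M) (x' : ∀ (θ : ℝ) (u : M), TangentSpace (𝓡 d) (x θ u))
    (hx : ∀ θ ∈ J, ∀ u : M, HasMFDerivWithinAt 𝓘(ℝ, ℝ) (𝓡 d) (fun s => x s u) J θ
      ((1 : ℝ →L[ℝ] ℝ).smulRight (x' θ u)))
    (hx_cont : ContinuousOn (fun p : ℝ × M => x p.1 p.2) (J ×ˢ univ))
    (hx'_cont : ContinuousOn
      (fun p : ℝ × M => (⟨x p.1 p.2, x' p.1 p.2⟩ : TangentBundle (𝓡 d) M)) (J ×ˢ univ)) :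
    ∀ θ ∈ J, ∀ G : (∀ y : M, TangentSpace (𝓡 d) y),
      IsIntrinsicGradient F (pushforward (x θ) μ) G →
        Integrable (fun u => inner ℝ (G (x θ u)) (x' θ u)) (μ : Measure M) ∧
        HasDerivWithinAt (fun s => F (pushforward (x s) μ))
          (∫ u, inner ℝ (G (x θ u)) (x' θ u) ∂(μ : Measure M)) J θ := by
  obtain ⟨C, hC⟩ := hF.lipschitz
  obtain ⟨D, hD, hDc, K, hDK⟩ := hF.derivative
  intro θ hθ G hG
  have hxθ : ContinuousOn (x θ) univ :=
    hx_cont.comp (f := fun u : M => (θ, u)) (by fun_prop) fun u _ => ⟨hθ, mem_univ _⟩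
  have hx'θ : ContinuousOn (fun u => (⟨x θ u, x' θ u⟩ : TangentBundle (𝓡 d) M)) univ :=
    hx'_cont.comp (f := fun u : M => (θ, u)) (by fun_prop) fun u _ => ⟨hθ, mem_univ _⟩
  have hm : AEMeasurable (x θ) (μ : Measure M) :=
    (continuousOn_univ.1 hxθ).measurable.aemeasurable
  -- Equality almost everywhere for the image measure pulls back along `x θ`; the integral can then
  -- be computed with the continuous version `D`.
  have hae : ∀ᵐ u ∂(μ : Measure M), G (x θ u) = D (pushforward (x θ) μ) (x θ u) := by
    have h := hG.ae_eq (hD _)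
    rw [coe_pushforward hm] at h
    exact ae_of_ae_map hm h
  have hae' : ∀ᵐ u ∂(μ : Measure M), inner ℝ (D (pushforward (x θ) μ) (x θ u)) (x' θ u) =
      inner ℝ (G (x θ u)) (x' θ u) := by
    filter_upwards [hae] with u hu
    rw [hu]
  have hcont : Continuous fun u => inner ℝ (D (pushforward (x θ) μ) (x θ u)) (x' θ u) :=
    (continuous_inner_section (hDc _)).comp (continuousOn_univ.1 hx'θ)
  refine ⟨(hcont.integrable_of_hasCompactSupport (HasCompactSupport.of_compactSpace _)).congr
    hae', ?_⟩
  rw [← integral_congr_ae hae']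
  exact hasDerivWithinAt_pushforward hC hD hDc hDK hJ hx hx_cont hx'_cont hθ
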